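/- **A Hermitian fermionic field cannot satisfy the measurement no-signalling condition (MC); in other words, a fermionic field is not measurable.** *Setting.* Let $S$ be a finite set (spin states and particle species), $m\ge 0$, $p_0=\sqrt{m^2+|\vec p|^2}$, and let $\mathcal F$ be the fermionic (antisymmetric) Fock space over the one-particle space $L^2(\mathbb R^3;\mathbb C^S)$, with annihilation and creation operators satisfying $\{a(\vec p,\sigma),a^\dagger(\vec q,\tau)\}=\delta^{(3)}(\vec p-\vec q)\,\delta_{\sigma\tau}$, $\{a,a\}=\{a^\dagger,a^\dagger\}=0$. A *fermionic field* with components $\Phi_l$ is an operator-valued distribution on Minkowski space $\mathbb R^{1+3}$ of the form $$\Phi_l(t,\vec x)=\int \mathrm d^3p\sum_{\sigma\in S}\Big(u_l(\vec p,\sigma)\,e^{-i(p_0t-\vec p\cdot\vec x)}\,a(\vec p,\sigma)+v_l(\vec p,\sigma)\,e^{i(p_0t-\vec p\cdot\vec x)}\,a^\dagger(\vec p,\sigma)\Big),$$ where the coefficient functions $u_l,v_l$ are such that for every real $f\in C_c^\infty(\mathbb R^{1+3})$ the functions $\overline{u_l(\vec p,\sigma)}\,\tilde f(\vec p)$ and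 $v_l(\vec p,\sigma)\,\tilde f(\vec p)$, with $\tilde f(\vec p)=\int f(t,\vec x)\,e^{i(p_0t-\vec p\cdot\vec x)}\,\mathrm dt\,\mathrm d^3x$, are square integrable. The smeared operators $\Phi_l(f)=\int f\,\Phi_l$ are then bounded operators on $\mathcal F$. The field is *Hermitian* if $\Phi_l(f)^\dagger=\Phi_l(f)$ for all $l$ and all real $f$. *Condition (MC).* For all components $l,l'$ and all real test functions $f,g$ such that $x-y$ is spacelike for all $x\in\operatorname{supp}f$, $y\in\operatorname{supp}g$, a non-selective measurement of $\Phi_l(f)$ does not change the statistics of $\Phi_{l'}(g)$: for every density operator $\rho$ on $\mathcal F$ and every $\mu\in\operatorname{spec}\Phi_{l'}(g)$, $$\operatorname{tr}\Big(\Big(\sum_{\lambda\in\operatorname{spec}\Phi_l(f)}\Pi_\lambda\,\rho\,\Pi_\lambda\Big)\Pi'_\mu\Big)=\operatorname{tr}\big(\rho\,\Pi'_\mu\big),$$ where $\Pi_\lambda$ and $\Pi'_\mu$ are the spectral projectors (orthogonal projectors onto the eigenspaces) of $\Phi_l(f)$ and $\Phi_{l'}(g)$. *Statement.* Let $\Phi$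 be a fermionic field that is not identically zero, i.e. $\Phi_l(f)\ne0$ for some component $l$ and some real test function $f$. Then $\Phi$ is not both Hermitian and subject to (MC). -/

import Mathlib

open scoped InnerProductSpace

/-! ## The fermionic Fock space of a complex Hilbert space -/

section Fock

variable (H : Type*) [NormedAddCommGroup H] [InnerProductSpace ℂ H]

/-- The finite-particle fermionic Fock space: the exterior algebra of the one-particle space `H`.
The vacuum is `1`, the state with particles `h₁, …, hₙ` is the wedge product `h₁ ∧ ⋯ ∧ hₙ`. -/
def FiniteFock : Type _ := ExteriorAlgebra ℂ H

noncomputable instance : Ring (FiniteFock H) := inferInstanceAs (Ring (ExteriorAlgebra ℂ H))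

noncomputable instance : Algebra ℂ (FiniteFock H) :=
  inferInstanceAs (Algebra ℂ (ExteriorAlgebra ℂ H))

namespace FiniteFock

variable {H}

/-- The one-particle state `h`. -/
noncomputable def single (h : H) : FiniteFock H := ExteriorAlgebra.ι ℂ h

/-- Creation of a particle with wave function `h`: the map `x ↦ h ∧ x`. -/
noncomputable def create (h : H) : FiniteFock H →ₗ[ℂ] FiniteFock H :=
  LinearMap.mulLeft ℂ (single h)

/-- Annihilation of a particle with wave function `h`: the contraction with `⟪h, ·⟫`, that is
`h₁ ∧ ⋯ ∧ hₙ ↦ ∑ⱼ (-1)^(j-1) ⟪h, hⱼ⟫ h₁ ∧ ⋯ ĥⱼ ⋯ ∧ hₙ`. -/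
noncomputable def annih (h : H) : FiniteFock H →ₗ[ℂ] FiniteFock H :=
  CliffordAlgebra.contractLeft (Q := (0 : QuadraticForm ℂ H)) (innerSL ℂ h).toLinearMap

/-- The coefficient of the vacuum. -/
noncomputable def vacuumCoeff : FiniteFock H →ₗ[ℂ] ℂ :=
  (ExteriorAlgebra.algebraMapInv (R := ℂ) (M := H)).toLinearMap

lemma induction {P : FiniteFock H → Prop} (scalar : ∀ r : ℂ, P (algebraMap ℂ _ r))
    (add : ∀ x y, P x → P y → P (x + y)) (mul : ∀ h x, P x → P (single h * x)) (x : FiniteFock H) :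
    P x :=
  CliffordAlgebra.left_induction (Q := (0 : QuadraticForm ℂ H)) (P := P) scalar add
    (fun x h hx => mul h x hx) x

lemma single_sq (h : H) : single h * single h = 0 := ExteriorAlgebra.ι_sq_zero h

lemma single_mul_swap (h k : H) : single h * single k = - (single k * single h) :=
  eq_neg_of_add_eq_zero_left (ExteriorAlgebra.ι_add_mul_swap h k)

lemma annih_scalar (h : H) (r : ℂ) : annih h (algebraMap ℂ (FiniteFock H) r) = 0 :=
  CliffordAlgebra.contractLeft_algebraMap (Q := (0 : QuadraticForm ℂ H)) _ r

lemma annih_single_mul (h k : H) (x : FiniteFock H) :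
    annih h (single k * x) = ⟪h, k⟫_ℂ • x - single k * annih h x :=
  CliffordAlgebra.contractLeft_ι_mul _ _ _

lemma annih_annih (h : H) (x : FiniteFock H) : annih h (annih h x) = 0 :=
  CliffordAlgebra.contractLeft_contractLeft _ _

lemma annih_add (h k : H) (x : FiniteFock H) : annih (h + k) x = annih h x + annih k x := by
  have : (innerSL ℂ (h + k)).toLinearMap
      = (innerSL ℂ h).toLinearMap + (innerSL ℂ k).toLinearMap := by
    ext; simp
  unfold annih
  rw [this, map_add]
  rfl

lemma annih_smul (c : ℂ) (h : H) (x : FiniteFock H) :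
    annih (c • h) x = (starRingEnd ℂ c) • annih h x := by
  have : (innerSL ℂ (c • h)).toLinearMap = (starRingEnd ℂ c) • (innerSL ℂ h).toLinearMap := by
    ext; simp
  unfold annih
  rw [this, map_smul]
  rfl

lemma vacuumCoeff_scalar (r : ℂ) : vacuumCoeff (algebraMap ℂ (FiniteFock H) r) = r :=
  ExteriorAlgebra.algebraMap_leftInverse H r

lemma vacuumCoeff_single_mul (h : H) (x : FiniteFock H) : vacuumCoeff (single h * x) = 0 := by
  have h1 : (ExteriorAlgebra.algebraMapInv (R := ℂ) (M := H)) (ExteriorAlgebra.ι ℂ h) = 0 := by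
    simp [ExteriorAlgebra.algebraMapInv]
  have h2 := map_mul (ExteriorAlgebra.algebraMapInv (R := ℂ) (M := H)) (ExteriorAlgebra.ι ℂ h) x
  rw [h1, zero_mul] at h2
  exact h2

/-- Precomposition of antilinear functionals with annihilation operators. -/
noncomputable def precomp :
    H →ₗ[ℂ] Module.End ℂ (FiniteFock H →ₗ⋆[ℂ] ℂ) where
  toFun h :=
    { toFun := fun φ => φ.comp (annih h)
      map_add' := fun _ _ => rfl
      map_smul' := fun _ _ => rfl }
  map_add' h k := by
    ext φ x; simp [annih_add]
  map_smul' c h := by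
    ext φ x; simp [annih_smul]

lemma precomp_sq (h : H) : precomp h * precomp h = 0 := by
  ext φ x
  simp [precomp, annih_annih]

/-- The antilinear functional `x ↦ conj (vacuumCoeff x)`. -/
noncomputable def vacuumFunctional : FiniteFock H →ₗ⋆[ℂ] ℂ where
  toFun x := starRingEnd ℂ (vacuumCoeff x)
  map_add' := by simp
  map_smul' := by simp

/-- The scalar product of the finite-particle Fock space, antilinear in `x`. It is determined by
`⟪x, 1⟫ = conj (vacuumCoeff x)` and `⟪x, h ∧ y⟫ = ⟪annih h x, y⟫`; on wedge products it is the
Gram determinant `det ⟪hᵢ, kⱼ⟫`. -/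
noncomputable def form (x y : FiniteFock H) : ℂ :=
  (ExteriorAlgebra.lift ℂ ⟨precomp, precomp_sq⟩ y) vacuumFunctional x

lemma form_add_left (x x' y : FiniteFock H) : form (x + x') y = form x y + form x' y := by
  simp [form]

lemma form_smul_left (c : ℂ) (x y : FiniteFock H) :
    form (c • x) y = starRingEnd ℂ c * form x y := by
  simp [form]

lemma form_add_right (x y y' : FiniteFock H) : form x (y + y') = form x y + form x y' := by
  have := map_add (ExteriorAlgebra.lift ℂ ⟨precomp (H := H), precomp_sq⟩) y y'
  unfold form
  exact (congrArg (fun T => T vacuumFunctional x) this)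

lemma form_scalar_right (x : FiniteFock H) (r : ℂ) :
    form x (algebraMap ℂ _ r) = r * starRingEnd ℂ (vacuumCoeff x) := by
  have := AlgHom.commutes (ExteriorAlgebra.lift ℂ ⟨precomp (H := H), precomp_sq⟩) r
  unfold form
  refine (congrArg (fun T => T vacuumFunctional x) this).trans ?_
  simp [vacuumFunctional, Algebra.algebraMap_eq_smul_one]

lemma form_single_mul_right (h : H) (x y : FiniteFock H) :
    form x (single h * y) = form (annih h x) y := by
  have := map_mul (ExteriorAlgebra.lift ℂ ⟨precomp (H := H), precomp_sq⟩)
    (ExteriorAlgebra.ι ℂ h) y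
  unfold form
  refine (congrArg (fun T => T vacuumFunctional x) this).trans ?_
  simp [precomp]

lemma form_smul_right (c : ℂ) (x y : FiniteFock H) : form x (c • y) = c * form x y := by
  have := map_smul (ExteriorAlgebra.lift ℂ ⟨precomp (H := H), precomp_sq⟩) c y
  unfold form
  exact (congrArg (fun T => T vacuumFunctional x) this)

lemma form_sub_left (x x' y : FiniteFock H) : form (x - x') y = form x y - form x' y := by
  simp [form]

lemma form_sub_right (x y y' : FiniteFock H) : form x (y - y') = form x y - form x y' := by
  rw [eq_sub_iff_add_eq, ← form_add_right, sub_add_cancel]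

lemma form_scalar_left (r : ℂ) (y : FiniteFock H) :
    form (algebraMap ℂ _ r) y = starRingEnd ℂ r * vacuumCoeff y := by
  induction y using induction with
  | scalar s => rw [form_scalar_right, vacuumCoeff_scalar, vacuumCoeff_scalar, mul_comm]
  | add x y hx hy => rw [form_add_right, hx, hy, map_add, mul_add]
  | mul h x hx =>
    rw [form_single_mul_right, annih_scalar, vacuumCoeff_single_mul, mul_zero]
    simp [form]

lemma form_single_mul_left (h : H) (x y : FiniteFock H) :
    form (single h * x) y = form x (annih h y) := by
  induction y using induction generalizing x with
  | scalar r =>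
    rw [form_scalar_right, annih_scalar, vacuumCoeff_single_mul, map_zero, mul_zero]
    simpa using (form_smul_right 0 x 0).symm
  | add y y' hy hy' => rw [form_add_right, hy, hy', map_add, form_add_right]
  | mul k y hy =>
    rw [form_single_mul_right, annih_single_mul, form_sub_left, form_smul_left, hy,
      annih_single_mul, form_sub_right, form_smul_right, form_single_mul_right, inner_conj_symm]

lemma form_conj_symm (x y : FiniteFock H) : starRingEnd ℂ (form y x) = form x y := by
  induction y using induction generalizing x with
  | scalar r => rw [form_scalar_right, form_scalar_left, map_mul, Complex.conj_conj]
  | add y y' hy hy' => rw [form_add_left, form_add_right, map_add, hy, hy']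
  | mul h y hy => rw [form_single_mul_left, form_single_mul_right, hy]

/-- The vectors that are built from the scalars and the first `d` members of a sequence `e`. -/
def Built (e : ℕ → H) : ℕ → FiniteFock H → Prop
  | 0, x => ∃ r : ℂ, x = algebraMap ℂ _ r
  | d + 1, x => ∃ u v, Built e d u ∧ Built e d v ∧ x = u + single (e d) * v

lemma Built.smul_add {e : ℕ → H} {d : ℕ} (c : ℂ) :
    ∀ {x y : FiniteFock H}, Built e d x → Built e d y → Built e d (c • x + y) := by
  induction d with
  | zero =>
    rintro x y ⟨r, rfl⟩ ⟨s, rfl⟩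
    exact ⟨c * r + s, by simp [Algebra.smul_def]⟩
  | succ d ih =>
    rintro x y ⟨u, v, hu, hv, rfl⟩ ⟨u', v', hu', hv', rfl⟩
    refine ⟨_, _, ih hu hu', ih hv hv', ?_⟩
    rw [mul_add, mul_smul_comm, _root_.smul_add]; abel

lemma Built.scalar (e : ℕ → H) (d : ℕ) (r : ℂ) : Built e d (algebraMap ℂ (FiniteFock H) r) := by
  induction d generalizing r with
  | zero => exact ⟨r, rfl⟩
  | succ d ih => exact ⟨_, _, ih r, ih 0, by simp⟩

lemma Built.zero (e : ℕ → H) (d : ℕ) : Built e d (0 : FiniteFock H) := by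
  simpa using Built.scalar e d 0

lemma Built.mul {e : ℕ → H} {d : ℕ} {k : ℕ} (hk : k < d) :
    ∀ {x : FiniteFock H}, Built e d x → Built e d (single (e k) * x) := by
  induction d with
  | zero => omega
  | succ d ih =>
    rintro x ⟨u, v, hu, hv, rfl⟩
    rcases Nat.lt_succ_iff_lt_or_eq.mp hk with h | rfl
    · refine ⟨_, _, ih h hu, by simpa using Built.smul_add (-1 : ℂ) (ih h hv) (Built.zero e d), ?_⟩
      rw [mul_add, ← mul_assoc, single_mul_swap]
      simp [mul_assoc]
    · exact ⟨0, u, Built.zero e k, hu, by rw [mul_add, ← mul_assoc, single_sq]; simp⟩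

lemma Built.annih_eq_zero {e : ℕ → H} {d : ℕ} {k : H} (hk : ∀ i < d, ⟪k, e i⟫_ℂ = 0) :
    ∀ {x : FiniteFock H}, Built e d x → annih k x = 0 := by
  induction d with
  | zero => rintro x ⟨r, rfl⟩; exact annih_scalar _ _
  | succ d ih =>
    rintro x ⟨u, v, hu, hv, rfl⟩
    rw [map_add, annih_single_mul, ih (fun i hi => hk i (by omega)) hu,
      ih (fun i hi => hk i (by omega)) hv, hk d (by omega)]
    simp

lemma Built.form_nonneg {e : ℕ → H} {d : ℕ}
    (he : ∀ i < d, ∀ j < d, ⟪e i, e j⟫_ℂ = if i = j then 1 else 0) :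
    ∀ {x : FiniteFock H}, Built e d x → 0 ≤ (form x x).re := by
  induction d with
  | zero =>
    rintro x ⟨r, rfl⟩
    rw [form_scalar_right, vacuumCoeff_scalar, Complex.mul_conj]
    exact_mod_cast Complex.normSq_nonneg r
  | succ d ih =>
    rintro x ⟨u, v, hu, hv, rfl⟩
    have h0 : ∀ i < d, ⟪e d, e i⟫_ℂ = 0 := fun i hi => by
      rw [he d (by omega) i (by omega), if_neg (by omega)]
    have h1 : ⟪e d, e d⟫_ℂ = 1 := by rw [he d (by omega) d (by omega), if_pos rfl]
    have hu0 := hu.annih_eq_zero h0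
    have hv0 := hv.annih_eq_zero h0
    have z' (y : FiniteFock H) : form y 0 = 0 := by simpa using form_smul_right 0 y 0
    have : form (u + single (e d) * v) (u + single (e d) * v) = form u u + form v v := by
      simp only [form_add_left, form_add_right, form_single_mul_left, form_single_mul_right, map_add,
        hu0, annih_single_mul, hv0, h1, z', mul_zero, sub_zero, one_smul, zero_add, add_zero]
    rw [this, Complex.add_re]
    have hle : ∀ i < d, ∀ j < d, ⟪e i, e j⟫_ℂ = if i = j then 1 else 0 :=
      fun i hi j hj => he i (by omega) j (by omega)
    exact add_nonneg (ih hle hu) (ih hle hv)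

lemma exists_built (x : FiniteFock H) : ∃ V : Submodule ℂ H, FiniteDimensional ℂ V ∧
    ∀ (e : ℕ → H) (d : ℕ), (∀ h ∈ V, h ∈ Submodule.span ℂ (e '' Set.Iio d)) → Built e d x := by
  induction x using induction with
  | scalar r => exact ⟨⊥, inferInstance, fun e d _ => Built.scalar e d r⟩
  | add x y hx hy =>
    obtain ⟨V, hV, hx⟩ := hx
    obtain ⟨W, hW, hy⟩ := hy
    refine ⟨V ⊔ W, inferInstance, fun e d h => ?_⟩
    simpa using Built.smul_add (1 : ℂ) (hx e d fun k hk => h k (Submodule.mem_sup_left hk))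
      (hy e d fun k hk => h k (Submodule.mem_sup_right hk))
  | mul k x hx =>
    obtain ⟨V, hV, hx⟩ := hx
    refine ⟨V ⊔ Submodule.span ℂ {k}, inferInstance, fun e d h => ?_⟩
    have hx' := hx e d fun l hl => h l (Submodule.mem_sup_left hl)
    have hk := h k (Submodule.mem_sup_right (Submodule.mem_span_singleton_self k))
    clear h
    have single_add (a b : H) : single (a + b) = single a + single b := map_add _ a b
    have single_smul (c : ℂ) (a : H) : single (c • a) = c • single a := map_smul _ c a
    induction hk using Submodule.span_induction with
    | mem k hk => obtain ⟨i, hi, rfl⟩ := hk; exact Built.mul hi hx'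
    | zero =>
      have : single (0 : H) = 0 := map_zero (ExteriorAlgebra.ι ℂ)
      rw [this, zero_mul]; exact Built.zero e d
    | add a b _ _ ha hb =>
      rw [single_add, add_mul]; simpa using Built.smul_add (1 : ℂ) ha hb
    | smul c a _ ha =>
      rw [single_smul, smul_mul_assoc]; simpa using Built.smul_add c ha (Built.zero e d)

lemma form_self_nonneg (x : FiniteFock H) : 0 ≤ (form x x).re := by
  obtain ⟨V, hV, hx⟩ := exists_built x
  let b := stdOrthonormalBasis ℂ V
  let e : ℕ → H := fun i => if h : i < Module.finrank ℂ V then (b ⟨i, h⟩ : H) else 0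
  refine Built.form_nonneg (e := e) (d := Module.finrank ℂ V) ?_ (hx e _ ?_)
  · intro i hi j hj
    have := orthonormal_iff_ite.mp b.orthonormal ⟨i, hi⟩ ⟨j, hj⟩
    simp only [e, hi, hj, dif_pos]
    rw [← Submodule.coe_inner, this]
    simp
  · intro h hh
    have h1 := b.sum_repr ⟨h, hh⟩
    have h2 : (∑ i, b.repr ⟨h, hh⟩ i • (b i : H)) = h := by
      simpa using congrArg (Subtype.val) h1
    rw [← h2]
    refine Submodule.sum_mem _ fun i _ => Submodule.smul_mem _ _ (Submodule.subset_span ?_)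
    exact ⟨i, i.2, by simp [e]⟩

/-- The scalar product of the finite-particle Fock space. -/
noncomputable abbrev core : PreInnerProductSpace.Core ℂ (FiniteFock H) where
  inner := form
  conj_inner_symm := form_conj_symm
  re_inner_nonneg := form_self_nonneg
  add_left := form_add_left
  smul_left x y r := form_smul_left r x y

noncomputable instance : SeminormedAddCommGroup (FiniteFock H) :=
  @InnerProductSpace.Core.toSeminormedAddCommGroup ℂ _ _ _ _ core

noncomputable instance : InnerProductSpace ℂ (FiniteFock H) := InnerProductSpace.ofCore core

lemma inner_create (h : H) (x y : FiniteFock H) :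
    ⟪create h x, y⟫_ℂ = ⟪x, annih h y⟫_ℂ :=
  form_single_mul_left h x y

/-- The canonical anticommutation relation. -/
lemma annih_create (h k : H) (x : FiniteFock H) :
    annih h (create k x) + create k (annih h x) = ⟪h, k⟫_ℂ • x :=
  sub_eq_iff_eq_add.mp (annih_single_mul h k x).symm |>.symm

lemma norm_create_le (h : H) (x : FiniteFock H) : ‖create h x‖ ≤ ‖h‖ * ‖x‖ := by
  have h1 : ⟪create h x, create h x⟫_ℂ = ⟪h, h⟫_ℂ * ⟪x, x⟫_ℂ - ⟪annih h x, annih h x⟫_ℂ := by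
    rw [inner_create, eq_sub_of_add_eq (annih_create h h x), inner_sub_right, inner_smul_right,
      ← inner_conj_symm x (create h _), inner_create, inner_conj_symm]
  simp only [inner_self_eq_norm_sq_to_K] at h1
  have h2 : ‖create h x‖ ^ 2 = ‖h‖ ^ 2 * ‖x‖ ^ 2 - ‖annih h x‖ ^ 2 := by exact_mod_cast h1
  refine abs_le_of_sq_le_sq' ?_ (by positivity) |>.2
  nlinarith [sq_nonneg ‖annih h x‖]

end FiniteFock

/-- The fermionic Fock space over `H`: the Hilbert space completion of the finite-particle space. -/
abbrev Fock : Type _ := UniformSpace.Completion (FiniteFock H)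

namespace Fock

variable {H}

/-- The creation operator `a†(h)` on the fermionic Fock space, linear in `h`. -/
noncomputable def create (h : H) : Fock H →L[ℂ] Fock H :=
  ((FiniteFock.create h).mkContinuous ‖h‖ (FiniteFock.norm_create_le h)).completion

/-- The annihilation operator `a(h)` on the fermionic Fock space, antilinear in `h`. -/
noncomputable def annih (h : H) : Fock H →L[ℂ] Fock H :=
  ContinuousLinearMap.adjoint (create h)

end Fock

end Fock

/-! ## Measurements -/

section Measurement

variable {F : Type*} [NormedAddCommGroup F] [InnerProductSpace ℂ F] [CompleteSpace F]

/-- The trace of an operator, computed in an orthonormal basis. It does not depend on the basis for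
trace-class operators, the only ones of which the trace is taken below. -/
noncomputable def operatorTrace (T : F →L[ℂ] F) : ℂ :=
  ∑' i, ⟪(exists_hilbertBasis ℂ F).choose_spec.choose i,
    T ((exists_hilbertBasis ℂ F).choose_spec.choose i)⟫_ℂ

/-- Density operators: positive operators with trace `1`. -/
def IsDensityOperator (ρ : F →L[ℂ] F) : Prop := ρ.IsPositive ∧ operatorTrace ρ = 1

/-- The spectral projector of `A` at `c`: the orthogonal projector onto the eigenspace. -/
noncomputable def spectralProjector (A : F →L[ℂ] F) (c : ℂ) : F →L[ℂ] F :=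
  (A - c • ContinuousLinearMap.id ℂ F).ker.starProjection

/-- The state after a non-selective measurement of `A` in the state `ρ` (projection postulate). -/
noncomputable def measured (A ρ : F →L[ℂ] F) : F →L[ℂ] F :=
  ∑' c : spectrum ℂ A, spectralProjector A c * ρ * spectralProjector A c

/-- A non-selective measurement of `A` does not affect the statistics of `B`, in any state. -/
def MeasurementLeavesInvariant (A B : F →L[ℂ] F) : Prop :=
  ∀ ρ : F →L[ℂ] F, IsDensityOperator ρ → ∀ c ∈ spectrum ℂ B,
    operatorTrace (measured A ρ * spectralProjector B c)
      = operatorTrace (ρ * spectralProjector B c)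

end Measurement

/-! ## Fermionic quantum fields on Minkowski space -/

/-- Three-dimensional Euclidean space, of positions or of momenta. -/
abbrev Space3 : Type := EuclideanSpace ℝ (Fin 3)

/-- Minkowski space: pairs (time, position), with the speed of light equal to `1`. -/
abbrev Spacetime : Type := ℝ × Space3

/-- The interval `x - y` is spacelike. -/
def Spacelike (x y : Spacetime) : Prop := (x.1 - y.1) ^ 2 < ‖x.2 - y.2‖ ^ 2

/-- Real smooth compactly supported functions on Minkowski space. -/
abbrev RealTestFunction : Type := TestFunction (⊤ : TopologicalSpace.Opens Spacetime) ℝ ⊤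

/-- The supports of `f` and `g` are spacelike separated. -/
def SpacelikeSeparated (f g : RealTestFunction) : Prop :=
  ∀ x ∈ tsupport f, ∀ y ∈ tsupport g, Spacelike x y

/-- The phase `p₀ t - p · x` with `p₀ = √(m² + |p|²)`. -/
noncomputable def phase (m : ℝ) (p : Space3) (x : Spacetime) : ℝ :=
  √(m ^ 2 + ‖p‖ ^ 2) * x.1 - ⟪p, x.2⟫_ℝ

/-- The smeared plane wave `∫ f(x) exp (i (p₀ t - p · x)) d⁴x`. -/
noncomputable def waveTransform (m : ℝ) (f : RealTestFunction) (p : Space3) : ℂ :=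
  ∫ x : Spacetime, (f x : ℂ) * Complex.exp (Complex.I * (phase m p x : ℂ))

/-- The one-particle Hilbert space of square integrable momentum wave functions; `S` indexes the
spin states and, if there are several particle species (such as a particle and its antiparticle),
the species. -/
abbrev OneParticle (S : Type*) [Fintype S] : Type _ :=
  MeasureTheory.Lp (EuclideanSpace ℂ S) 2 (MeasureTheory.volume : MeasureTheory.Measure Space3)

/-- A fermionic quantum field, with components indexed by `ι`:
`Φ_l(t, x) = ∫ d³p ∑_σ (u_l(p,σ) exp (-i (p₀ t - p · x)) a(p,σ)`
`+ v_l(p,σ) exp (i (p₀ t - p · x)) a†(p,σ))`,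
where `a(p,σ)`, `a†(p,σ)` are the annihilation and creation operators of the fermionic Fock space,
`{a(p,σ), a†(q,τ)} = δ³(p - q) δ_στ`. The last two fields of the structure say that the smeared
operators make sense. -/
structure FermionicField (ι S : Type*) [Fintype S] where
  /-- the mass of the particles -/
  mass : ℝ
  mass_nonneg : 0 ≤ mass
  /-- coefficients of the annihilation operators -/
  u : ι → Space3 → S → ℂ
  /-- coefficients of the creation operators -/
  v : ι → Space3 → S → ℂ
  memLp_u : ∀ (l : ι) (f : RealTestFunction),
    MeasureTheory.MemLp (fun p => (WithLp.toLp 2 fun σ =>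
      waveTransform mass f p * starRingEnd ℂ (u l p σ) : EuclideanSpace ℂ S)) 2
      MeasureTheory.volume
  memLp_v : ∀ (l : ι) (f : RealTestFunction),
    MeasureTheory.MemLp (fun p => (WithLp.toLp 2 fun σ =>
      waveTransform mass f p * v l p σ : EuclideanSpace ℂ S)) 2 MeasureTheory.volume

namespace FermionicField

variable {ι S : Type*} [Fintype S]

/-- The smeared field operator `Φ_l(f) = ∫ f(x) Φ_l(x) d⁴x`. -/
noncomputable def smeared (Φ : FermionicField ι S) (l : ι) (f : RealTestFunction) :
    Fock (OneParticle S) →L[ℂ] Fock (OneParticle S) :=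
  Fock.annih ((Φ.memLp_u l f).toLp _) + Fock.create ((Φ.memLp_v l f).toLp _)

/-- The field is Hermitian: `Φ_l(x)† = Φ_l(x)` for all components `l`, in the sense of
operator-valued distributions. -/
def IsHermitian (Φ : FermionicField ι S) : Prop :=
  ∀ (l : ι) (f : RealTestFunction), IsSelfAdjoint (Φ.smeared l f)

/-- Condition (MC): non-selective measurements of the field do not affect the statistics of the
field at spacelike separation. -/
def SatisfiesMC (Φ : FermionicField ι S) : Prop :=
  ∀ (l l' : ι) (f g : RealTestFunction), SpacelikeSeparated f g →
    MeasurementLeavesInvariant (Φ.smeared l f) (Φ.smeared l' g)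

end FermionicField

/-!
A Hermitian smeared field has the form `φ(h) = a(h) + a†(h)`, where `h` is the momentum wave function
of the test function (`Fock.eq_of_isSelfAdjoint_annih_add_create`). By the canonical anticommutation
relations `φ(h) φ(k) + φ(k) φ(h) = 2 Re ⟪h, k⟫`; in particular `φ(h)² = ‖h‖²`, so that `φ(h)` is an
observable with the values `± ‖h‖`. The non-selective measurement of such an observable `A`,
`A² = r²`, is `ρ ↦ (ρ + A ρ A / r²) / 2`, and it leaves the statistics of another one unchanged in
all pure states only if the two commute (`MeasurementLeavesInvariant.commute`).

Hence, if `f` and `g` are spacelike separated, the operators `φ(h)` and `φ(k)` of the same field both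
commute and have a real scalar as anticommutator, which forces `k` to be a real multiple of `h` when
`h ≠ 0` (`Fock.exists_real_smul_of_measurementLeavesInvariant`). Take for `g` a spatial translate of
`f` by a vector `a` so large that the supports are spacelike separated. Then `k` is `h` multiplied by
the plane wave `exp (-i a · p)`, which is non-real for almost all `p`; so `k` is a real multiple of `h`
only if `h = 0` (`ae_eq_zero_of_plane_wave_smul`), that is, if `φ(h) = 0`.
-/

/-! ### Measurement of observables with two opposite values -/

section Measurement

variable {F : Type*} [NormedAddCommGroup F] [InnerProductSpace ℂ F] [CompleteSpace F]

lemma operatorTrace_rankOne_add_rankOne (x y x' y' : F) :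
    operatorTrace (InnerProductSpace.rankOne ℂ x y + InnerProductSpace.rankOne ℂ x' y')
      = ⟪y, x⟫_ℂ + ⟪y', x'⟫_ℂ := by
  unfold operatorTrace
  generalize (exists_hilbertBasis ℂ F).choose_spec.choose = b
  have h := (b.hasSum_inner_mul_inner y x).add (b.hasSum_inner_mul_inner y' x')
  rw [← h.tsum_eq]
  refine tsum_congr fun i => ?_
  simp

lemma operatorTrace_rankOne (x y : F) :
    operatorTrace (InnerProductSpace.rankOne ℂ x y) = ⟪y, x⟫_ℂ := by
  simpa using operatorTrace_rankOne_add_rankOne x y 0 0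

lemma isDensityOperator_rankOne {x : F} (hx : ‖x‖ = 1) :
    IsDensityOperator (InnerProductSpace.rankOne ℂ x x) :=
  ⟨InnerProductSpace.isPositive_rankOne_self x, by simp [operatorTrace_rankOne, hx]⟩

lemma spectralProjector_eq_zero_of_ker {A : F →L[ℂ] F} {c : ℂ} (h : ∀ x, A x = c • x → x = 0) :
    spectralProjector A c = 0 := by
  ext x
  exact h _ (sub_eq_zero.mp
    ((A - c • ContinuousLinearMap.id ℂ F).ker.starProjection_apply_mem x))

lemma spectralProjector_eq_zero_of_notMem_spectrum {A : F →L[ℂ] F} {c : ℂ}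
    (hc : c ∉ spectrum ℂ A) : spectralProjector A c = 0 := by
  refine spectralProjector_eq_zero_of_ker fun x hx => ?_
  obtain ⟨u, hu⟩ := spectrum.notMem_iff.mp hc
  have h1 : (u : F →L[ℂ] F) x = 0 := by
    rw [hu]
    simp [Algebra.algebraMap_eq_smul_one, hx]
  have h2 : (↑u⁻¹ : F →L[ℂ] F) ((u : F →L[ℂ] F) x) = x :=
    congrArg (fun T : F →L[ℂ] F => T x) u.inv_mul
  rw [← h2, h1, map_zero]

lemma spectralProjector_eq_zero_of_sq_ne {A : F →L[ℂ] F} {a c : ℂ} (hA2 : A * A = a • 1)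
    (hc : c ^ 2 ≠ a) : spectralProjector A c = 0 := by
  refine spectralProjector_eq_zero_of_ker fun x hx => ?_
  have h : A (A x) = a • x := by
    simpa using congrArg (fun T : F →L[ℂ] F => T x) hA2
  rw [hx, map_smul, hx, smul_smul, ← sub_eq_zero, ← sub_smul, ← sq] at h
  simpa [sub_ne_zero.mpr hc] using h

/-- If `A² = r²`, the projector onto the eigenspace at `r` is `(1 + A / r) / 2`; applied to `-r` it
also gives the projector at the opposite eigenvalue. -/
lemma spectralProjector_eq_of_mul_self {A : F →L[ℂ] F} (hA : IsSelfAdjoint A) {r : ℝ} (hr : r ≠ 0)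
    (hA2 : A * A = ((r : ℂ) ^ 2) • 1) :
    spectralProjector A r = (2⁻¹ : ℂ) • (1 + (r : ℂ)⁻¹ • A) := by
  have hr' : (r : ℂ) ≠ 0 := by exact_mod_cast hr
  have hAA (x : F) : A (A x) = (r : ℂ) ^ 2 • x := by
    simpa using congrArg (fun T : F →L[ℂ] F => T x) hA2
  ext x
  refine Submodule.eq_starProjection_of_mem_orthogonal' (u := x)
    (v := (2⁻¹ : ℂ) • (x + (r : ℂ)⁻¹ • A x)) (z := (2⁻¹ : ℂ) • (x - (r : ℂ)⁻¹ • A x)) ?_ ?_ ?_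
  · refine sub_eq_zero.mpr ?_
    change A _ = (r : ℂ) • ((2⁻¹ : ℂ) • (x + (r : ℂ)⁻¹ • A x))
    rw [map_smul, map_add, map_smul, hAA]
    match_scalars <;> field_simp
  · rw [Submodule.mem_orthogonal]
    intro w hw
    have hw' : A w = (r : ℂ) • w := sub_eq_zero.mp hw
    have : ⟪w, A x⟫_ℂ = r * ⟪w, x⟫_ℂ := by
      rw [← ContinuousLinearMap.adjoint_inner_left, ← ContinuousLinearMap.star_eq_adjoint,
        hA.star_eq, hw', inner_smul_left, Complex.conj_ofReal]
    rw [inner_smul_right, inner_sub_right, inner_smul_right, this]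
    field_simp
    ring
  · rw [← smul_add, add_add_sub_cancel, ← two_smul ℂ x, smul_smul]; norm_num

/-- Measuring `A` with `A² = r²` turns the state `ρ` into the equal mixture of `ρ` and
`A ρ A / r²`. -/
lemma measured_eq_of_mul_self {A : F →L[ℂ] F} (hA : IsSelfAdjoint A) {r : ℝ} (hr : r ≠ 0)
    (hA2 : A * A = ((r : ℂ) ^ 2) • 1) (ρ : F →L[ℂ] F) :
    measured A ρ = (2⁻¹ : ℂ) • (ρ + ((r : ℂ) ^ 2)⁻¹ • (A * ρ * A)) := by
  have hr' : (r : ℂ) ≠ 0 := by exact_mod_cast hr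
  have hne : (r : ℂ) ≠ ((-r : ℝ) : ℂ) := by
    push_cast
    exact fun h => hr' (self_eq_neg.mp h)
  unfold measured
  -- Points outside the spectrum contribute `0`, so the sum may run over all complex numbers.
  rw [tsum_subtype_eq_of_support_subset
    (f := fun c : ℂ => spectralProjector A c * ρ * spectralProjector A c),
    tsum_eq_sum (s := {(r : ℂ), ((-r : ℝ) : ℂ)}), Finset.sum_pair hne,
    spectralProjector_eq_of_mul_self hA hr hA2,
    spectralProjector_eq_of_mul_self hA (neg_ne_zero.mpr hr) (by push_cast; rwa [neg_sq])]
  · push_cast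
    simp only [mul_add, add_mul, smul_add, mul_smul_comm, smul_mul_assoc, one_mul, mul_one,
      mul_assoc]
    match_scalars <;> field_simp <;> ring
  · intro c hc
    rw [spectralProjector_eq_zero_of_sq_ne hA2, zero_mul, zero_mul]
    rw [Ne, sq_eq_sq_iff_eq_or_eq_neg]
    simpa using hc
  · intro c hc
    by_contra h
    exact hc (by simp [spectralProjector_eq_zero_of_notMem_spectrum h])

/-- For observables with two opposite values, no-signalling amounts to commutativity: the pure states
show that the projectors of `B` are fixed by `P ↦ (P + A P A / r²) / 2`. -/
theorem MeasurementLeavesInvariant.commute {A B : F →L[ℂ] F} (h : MeasurementLeavesInvariant A B)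
    (hA : IsSelfAdjoint A) (hB : IsSelfAdjoint B) {r s : ℝ} (hr : r ≠ 0) (hs : s ≠ 0)
    (hA2 : A * A = ((r : ℂ) ^ 2) • 1) (hB2 : B * B = ((s : ℂ) ^ 2) • 1) : Commute A B := by
  have hr' : (r : ℂ) ≠ 0 := by exact_mod_cast hr
  have hs' : (s : ℂ) ≠ 0 := by exact_mod_cast hs
  set P := spectralProjector B s with hP
  have hPsa : IsSelfAdjoint P := isSelfAdjoint_starProjection _
  have key (x : F) (hx : ‖x‖ = 1) :
      (2⁻¹ : ℂ) * (⟪P x, x⟫_ℂ + ((r : ℂ) ^ 2)⁻¹ * ⟪P (A x), A x⟫_ℂ) = ⟪P x, x⟫_ℂ := by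
    have h1 : operatorTrace (measured A (InnerProductSpace.rankOne ℂ x x) * P)
        = operatorTrace (InnerProductSpace.rankOne ℂ x x * P) := by
      -- If `s` is not a spectral value of `B`, then `P = 0` and both sides vanish.
      by_cases hc : (s : ℂ) ∈ spectrum ℂ B
      · exact h _ (isDensityOperator_rankOne hx) _ hc
      · rw [hP, spectralProjector_eq_zero_of_notMem_spectrum hc, mul_zero, mul_zero]
    have h2 : InnerProductSpace.rankOne ℂ x x * P = InnerProductSpace.rankOne ℂ x (P x) := by
      ext y
      simp [← ContinuousLinearMap.adjoint_inner_left, ← ContinuousLinearMap.star_eq_adjoint,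
        hPsa.star_eq]
    have h3 : measured A (InnerProductSpace.rankOne ℂ x x) * P
        = InnerProductSpace.rankOne ℂ ((2⁻¹ : ℂ) • x) (P x)
          + InnerProductSpace.rankOne ℂ ((2⁻¹ * ((r : ℂ) ^ 2)⁻¹) • A x) (P (A x)) := by
      rw [measured_eq_of_mul_self hA hr hA2]
      ext y
      have hy : ⟪x, A (P y)⟫_ℂ = ⟪P (A x), y⟫_ℂ := by
        rw [← ContinuousLinearMap.adjoint_inner_left, ← ContinuousLinearMap.star_eq_adjoint,
          hA.star_eq, ← ContinuousLinearMap.adjoint_inner_left,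
          ← ContinuousLinearMap.star_eq_adjoint, hPsa.star_eq]
      have hy' : ⟪x, P y⟫_ℂ = ⟪P x, y⟫_ℂ := by
        rw [← ContinuousLinearMap.adjoint_inner_left, ← ContinuousLinearMap.star_eq_adjoint,
          hPsa.star_eq]
      simp [hy, hy']
      match_scalars
      ring
    rw [h2, h3, operatorTrace_rankOne_add_rankOne, operatorTrace_rankOne, inner_smul_right,
      inner_smul_right] at h1
    linear_combination h1
  have hAPA : A * P * A = ((r : ℂ) ^ 2) • P := by
    -- A bounded operator on a complex Hilbert space is determined by its quadratic form.
    apply ContinuousLinearMap.coe_injective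
    rw [← ext_inner_map]
    intro x
    have hx : ⟪A (P (A x)), x⟫_ℂ = (r : ℂ) ^ 2 * ⟪P x, x⟫_ℂ := by
      rw [← hA.star_eq, ContinuousLinearMap.star_eq_adjoint,
        ContinuousLinearMap.adjoint_inner_left, ← ContinuousLinearMap.star_eq_adjoint, hA.star_eq]
      rcases eq_or_ne x 0 with rfl | hx0
      · simp
      have hn : ((‖x‖ : ℝ) : ℂ) ≠ 0 := by exact_mod_cast norm_ne_zero_iff.mpr hx0
      have := key (((‖x‖ : ℝ) : ℂ)⁻¹ • x) (by simp [norm_smul, hx0])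
      simp only [map_smul, inner_smul_left, inner_smul_right, map_inv₀, Complex.conj_ofReal] at this
      field_simp at this
      linear_combination this
    simpa [inner_smul_left] using hx
  have hAP : Commute A P := by
    have h2 := congrArg (fun T => T * A) hAPA
    simp only [mul_assoc, hA2, mul_smul_comm, mul_one, smul_mul_assoc] at h2
    exact smul_right_injective _ (pow_ne_zero 2 hr') h2
  have hBP : B = (s : ℂ) • ((2 : ℂ) • P - 1) := by
    rw [hP, spectralProjector_eq_of_mul_self hB hs hB2]
    match_scalars <;> field_simp
    ring
  rw [hBP]
  exact ((hAP.smul_right _).sub_right (Commute.one_right A)).smul_right _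

end Measurement

/-! ### Field operators on the fermionic Fock space -/

namespace Fock

variable {H : Type*} [NormedAddCommGroup H] [InnerProductSpace ℂ H]

/-- The vacuum vector. -/
noncomputable def vacuum : Fock H := ((1 : FiniteFock H) : Fock H)

lemma create_coe (h : H) (x : FiniteFock H) :
    create h (x : Fock H) = (FiniteFock.create h x : FiniteFock H) := by
  unfold create
  rw [ContinuousLinearMap.completion_apply_coe]
  rfl

lemma annih_coe (h : H) (x : FiniteFock H) :
    annih h (x : Fock H) = (FiniteFock.annih h x : FiniteFock H) := by
  refine ext_inner_left ℂ fun y => ?_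
  unfold annih
  rw [ContinuousLinearMap.adjoint_inner_right]
  induction y using UniformSpace.Completion.induction_on with
  | hp => exact isClosed_eq (by fun_prop) (by fun_prop)
  | ih y => rw [create_coe, UniformSpace.Completion.inner_coe, UniformSpace.Completion.inner_coe,
      FiniteFock.inner_create]

lemma ext_coe {S T : Fock H →L[ℂ] Fock H} (h : ∀ x : FiniteFock H, S x = T x) : S = T :=
  DFunLike.coe_injective <| UniformSpace.Completion.ext S.continuous T.continuous h

lemma create_smul (c : ℂ) (h : H) : create (c • h) = c • create h := by
  refine ext_coe fun x => ?_
  have hx : FiniteFock.create (c • h) x = c • FiniteFock.create h x := by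
    change FiniteFock.single (c • h) * x = c • (FiniteFock.single h * x)
    rw [← Algebra.smul_mul_assoc]
    exact congrArg (· * x) (map_smul (ExteriorAlgebra.ι ℂ) c h)
  simp [create_coe, hx, UniformSpace.Completion.coe_smul]

lemma create_zero : create (0 : H) = 0 := by
  simpa using create_smul (0 : ℂ) (0 : H)

lemma annih_vacuum (h : H) : annih h (vacuum : Fock H) = 0 := by
  have := FiniteFock.annih_scalar h 1
  rw [map_one] at this
  rw [vacuum, annih_coe, this, UniformSpace.Completion.coe_zero]

/-- The canonical anticommutation relation `{a(h), a†(k)} = ⟪h, k⟫`. -/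
lemma annih_mul_create_add (h k : H) :
    annih h * create k + create k * annih h = ⟪h, k⟫_ℂ • (1 : Fock H →L[ℂ] Fock H) := by
  refine ext_coe fun x => ?_
  simp [create_coe, annih_coe, ← UniformSpace.Completion.coe_add,
    FiniteFock.annih_create, ← UniformSpace.Completion.coe_smul]

lemma create_mul_create_add (h k : H) :
    create h * create k + create k * create h = (0 : Fock H →L[ℂ] Fock H) := by
  refine ext_coe fun x => ?_
  have : FiniteFock.create h (FiniteFock.create k x)
      + FiniteFock.create k (FiniteFock.create h x) = 0 := by
    change FiniteFock.single h * (FiniteFock.single k * x)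
      + FiniteFock.single k * (FiniteFock.single h * x) = 0
    rw [← mul_assoc, FiniteFock.single_mul_swap, neg_mul, mul_assoc, neg_add_cancel]
  simp [create_coe, ← UniformSpace.Completion.coe_add, this, UniformSpace.Completion.coe_zero]

lemma adjoint_create (h : H) : star (create h) = annih h := rfl

lemma adjoint_annih (h : H) : star (annih h) = create h := by
  rw [← adjoint_create, star_star]

lemma annih_mul_annih_add (h k : H) :
    annih h * annih k + annih k * annih h = (0 : Fock H →L[ℂ] Fock H) := by
  rw [← adjoint_create, ← adjoint_create, ← star_mul, ← star_mul, ← star_add,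
    create_mul_create_add, star_zero]

/-- The one-particle states `a†(h) Ω` form an isometric copy of the one-particle space. -/
lemma create_vacuum_injective : Function.Injective fun h : H => create h (vacuum : Fock H) := by
  intro h k hk
  have key (g l : H) : ⟪create g (vacuum : Fock H), create l vacuum⟫_ℂ = ⟪g, l⟫_ℂ := by
    have h1 := congrArg (fun T => T (vacuum : Fock H)) (annih_mul_create_add g l)
    have h2 : annih g (create l (vacuum : Fock H)) = ⟪g, l⟫_ℂ • vacuum := by
      simpa [annih_vacuum] using h1
    have h3 : ⟪(vacuum : Fock H), vacuum⟫_ℂ = 1 := by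
      rw [vacuum, UniformSpace.Completion.inner_coe]
      have := FiniteFock.form_scalar_left (H := H) 1 1
      have h1 := FiniteFock.vacuumCoeff_scalar (H := H) 1
      rw [map_one] at this h1
      rw [h1] at this
      rw [map_one, one_mul] at this
      exact this
    rw [← ContinuousLinearMap.adjoint_inner_right]
    change ⟪vacuum, annih g (create l (vacuum : Fock H))⟫_ℂ = _
    rw [h2, inner_smul_right, h3, mul_one]
  refine ext_inner_left ℂ fun g => ?_
  rw [← key, ← key]
  exact congrArg _ hk

/-- The Hermitian field operator `a(h) + a†(h)`. -/
noncomputable def field (h : H) : Fock H →L[ℂ] Fock H := annih h + create h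

lemma field_zero : field (0 : H) = 0 := by
  rw [field, ← adjoint_create, create_zero, star_zero, add_zero]

lemma isSelfAdjoint_field (h : H) : IsSelfAdjoint (field h) := by
  rw [IsSelfAdjoint, field, star_add, adjoint_annih, adjoint_create, add_comm]

/-- A sum `a(h) + a†(k)` is self-adjoint only for `h = k`, as its value on the vacuum shows. -/
lemma eq_of_isSelfAdjoint_annih_add_create {h k : H} (hs : IsSelfAdjoint (annih h + create k)) :
    h = k := by
  rw [IsSelfAdjoint, star_add, adjoint_annih, adjoint_create] at hs
  have := congrArg (fun T => T (vacuum : Fock H)) hs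
  simp only [add_apply, annih_vacuum, add_zero, zero_add] at this
  exact create_vacuum_injective this

lemma field_mul_field_add (h k : H) :
    field h * field k + field k * field h
      = ((2 * (⟪h, k⟫_ℂ).re : ℝ) : ℂ) • (1 : Fock H →L[ℂ] Fock H) := by
  have hre : ((2 * (⟪h, k⟫_ℂ).re : ℝ) : ℂ) = ⟪h, k⟫_ℂ + ⟪k, h⟫_ℂ := by
    rw [← inner_conj_symm k h, Complex.add_conj]
  rw [hre, add_smul, ← annih_mul_create_add, ← annih_mul_create_add]
  unfold field
  simp only [add_mul, mul_add]
  rw [← add_zero (annih h * create k + create k * annih h), ← annih_mul_annih_add h k,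
    ← add_zero (annih k * create h + create h * annih k), ← create_mul_create_add h k]
  abel

lemma field_mul_self (h : H) :
    field h * field h = (((‖h‖ : ℝ) : ℂ) ^ 2) • (1 : Fock H →L[ℂ] Fock H) := by
  have := field_mul_field_add h h
  rw [← two_smul ℂ (field h * field h)] at this
  have h2 : (⟪h, h⟫_ℂ).re = ‖h‖ ^ 2 := inner_self_eq_norm_sq (𝕜 := ℂ) h
  rw [h2] at this
  push_cast at this
  rw [mul_smul] at this
  exact smul_right_injective _ two_ne_zero this

/-- The anticommutator of two field operators is a real scalar. If they also commute, their product
is that scalar, so, both squares being scalars, one is a real multiple of the other. -/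
lemma exists_real_smul_of_commute {h k : H} (hh : h ≠ 0) (hc : Commute (field h) (field k)) :
    ∃ c : ℝ, k = (c : ℂ) • h := by
  have h1 := field_mul_field_add h k
  rw [← hc.eq, ← two_smul ℂ (field h * field k)] at h1
  push_cast at h1
  rw [mul_smul] at h1
  have h2 := smul_right_injective (Fock H →L[ℂ] Fock H) (two_ne_zero (α := ℂ)) h1
  -- Multiplying `φ(h) φ(k) = Re ⟪h, k⟫` by `φ(h)` gives `‖h‖² φ(k) = Re ⟪h, k⟫ φ(h)`.
  have h3 := congrArg (fun T => field h * T) h2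
  simp only [← mul_assoc, field_mul_self, smul_mul_assoc, one_mul, mul_smul_comm, mul_one] at h3
  have h4 := congrArg (fun T => T (vacuum : Fock H)) h3
  simp only [smul_apply, field, add_apply, annih_vacuum, zero_add] at h4
  rw [← smul_apply, ← smul_apply, ← create_smul, ← create_smul] at h4
  have h5 := create_vacuum_injective h4
  have hn : (((‖h‖ : ℝ) : ℂ) ^ 2) ≠ 0 := by
    exact_mod_cast pow_ne_zero 2 (norm_ne_zero_iff.mpr hh)
  refine ⟨(⟪h, k⟫_ℂ).re / ‖h‖ ^ 2, ?_⟩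
  conv_lhs => rw [← inv_smul_smul₀ hn k, h5, smul_smul]
  congr 1
  push_cast
  field_simp

/-- The wave functions of two field operators, one of which can be measured without affecting
the other, are real multiples of each other. -/
theorem exists_real_smul_of_measurementLeavesInvariant {h k : H} (hh : h ≠ 0)
    (hm : MeasurementLeavesInvariant (field h) (field k)) : ∃ c : ℝ, k = (c : ℂ) • h := by
  rcases eq_or_ne k 0 with rfl | hk
  · exact ⟨0, by simp⟩
  exact exists_real_smul_of_commute hh <| hm.commute (isSelfAdjoint_field h)
    (isSelfAdjoint_field k) (norm_ne_zero_iff.mpr hh) (norm_ne_zero_iff.mpr hk)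
    (field_mul_self h) (field_mul_self k)

end Fock

/-! ### Translation of test functions -/

namespace RealTestFunction

/-- The spatial translate `(t, x) ↦ f (t, x - a)` of a test function. -/
noncomputable def translate (f : RealTestFunction) (a : Space3) : RealTestFunction where
  toFun x := f (x - (0, a))
  contDiff' := f.contDiff.comp (contDiff_id.sub contDiff_const)
  hasCompactSupport' :=
    f.hasCompactSupport.comp_homeomorph (Homeomorph.subRight ((0, a) : Spacetime))
  tsupport_subset' := Set.subset_univ _

lemma translate_apply (f : RealTestFunction) (a : Space3) (x : Spacetime) :
    f.translate a x = f (x - (0, a)) := rfl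

/-- Spatial translation by `a` multiplies the momentum wave function by `exp (-i a · p)`. -/
lemma waveTransform_translate (m : ℝ) (f : RealTestFunction) (a p : Space3) :
    waveTransform m (f.translate a) p
      = Complex.exp (-(Complex.I * (⟪a, p⟫_ℝ : ℂ))) * waveTransform m f p := by
  have : (MeasureTheory.volume : MeasureTheory.Measure Spacetime).IsAddRightInvariant :=
    inferInstanceAs ((MeasureTheory.volume : MeasureTheory.Measure ℝ).prod
      (MeasureTheory.volume : MeasureTheory.Measure Space3)).IsAddRightInvariant
  unfold waveTransform
  rw [← MeasureTheory.integral_const_mul,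
    ← MeasureTheory.integral_add_right_eq_self _ ((0, a) : Spacetime)]
  refine MeasureTheory.integral_congr_ae (Filter.Eventually.of_forall fun x => ?_)
  have h : phase m p (x + (0, a)) = phase m p x - ⟪a, p⟫_ℝ := by
    simp only [phase, Prod.fst_add, Prod.snd_add, inner_add_right, add_zero, real_inner_comm p a]
    ring
  simp only [translate_apply, add_sub_cancel_right, h]
  rw [mul_left_comm, ← Complex.exp_add]
  push_cast
  ring_nf

lemma exists_spacelikeSeparated_translate (f : RealTestFunction) :
    ∃ a : Space3, a ≠ 0 ∧ SpacelikeSeparated f (f.translate a) := by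
  obtain ⟨R, hR⟩ := f.hasCompactSupport.isCompact.isBounded.exists_norm_le
  -- Points of the support of `f` differ by at most `2 * |R|` in time and in space, so that a shift by
  -- more than `4 * |R|` separates them.
  obtain ⟨e, he⟩ := exists_norm_eq Space3 (c := 4 * |R| + 1) (by positivity)
  refine ⟨e, fun h => ?_, fun x hx y hy => ?_⟩
  · rw [h, norm_zero] at he
    linarith [abs_nonneg R]
  have hy' : y - (0, e) ∈ tsupport f :=
    tsupport_comp_subset_preimage f (f := fun x : Spacetime => x - (0, e)) (by fun_prop) hy
  have hxR := (hR x hx).trans (le_abs_self R)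
  have hyR := (hR _ hy').trans (le_abs_self R)
  have hx1 := (norm_fst_le x).trans hxR
  have hx2 := (norm_snd_le x).trans hxR
  have hy1 := (norm_fst_le _).trans hyR
  have hy2 := (norm_snd_le _).trans hyR
  simp only [Prod.fst_sub, Prod.snd_sub, sub_zero] at hy1 hy2
  have ht : |x.1 - y.1| ≤ 2 * |R| := (norm_sub_le x.1 y.1).trans (by linarith)
  have hs : ‖e‖ ≤ ‖x.2 - y.2‖ + 2 * |R| := by
    have h1 : e = -(x.2 - y.2) + (x.2 - (y.2 - e)) := by abel
    have h2 := norm_add_le (-(x.2 - y.2)) (x.2 - (y.2 - e))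
    rw [← h1, norm_neg] at h2
    linarith [norm_sub_le x.2 (y.2 - e)]
  unfold Spacelike
  rw [← sq_abs]
  exact pow_lt_pow_left₀ (by linarith) (abs_nonneg _) two_ne_zero

end RealTestFunction

/-! ### Plane waves -/

/-- A nontrivial plane wave `exp (i a · p)` is non-real for almost every `p`: the exceptional momenta
are the preimage of the countable set `ℤ π` under a nonzero linear form. -/
lemma ae_sin_inner_ne_zero {a : Space3} (ha : a ≠ 0) : ∀ᵐ p : Space3, Real.sin ⟪a, p⟫_ℝ ≠ 0 := by
  have hsurj : Function.Surjective (innerₛₗ ℝ a) := by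
    refine LinearMap.surjective fun h => ha ?_
    simpa using congrArg (fun L => L a) h
  have hs : MeasurableSet {y : ℝ | Real.sin y ≠ 0} :=
    (isOpen_ne_fun Real.continuous_sin continuous_const).measurableSet
  refine (MeasureTheory.ae_comp_linearMap_mem_iff (innerₛₗ ℝ a) MeasureTheory.volume
    MeasureTheory.volume hsurj hs).mpr ?_
  have hc : {y : ℝ | Real.sin y ≠ 0}ᶜ ⊆ Set.range fun n : ℤ => (n : ℝ) * Real.pi := by
    intro y hy
    obtain ⟨n, hn⟩ := Real.sin_eq_zero_iff.mp (by simpa using hy)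
    exact ⟨n, hn⟩
  exact ((Set.countable_range _).mono hc).measure_zero _

/-- Multiplication by a nontrivial plane wave does not act on any nonzero wave function as a real
number. -/
lemma ae_eq_zero_of_plane_wave_smul {E : Type*} [AddCommGroup E] [Module ℂ E] {a : Space3}
    (ha : a ≠ 0) {F : Space3 → E} {c : ℝ}
    (h : ∀ᵐ p : Space3, Complex.exp (-(Complex.I * (⟪a, p⟫_ℝ : ℂ))) • F p = (c : ℂ) • F p) :
    ∀ᵐ p : Space3, F p = 0 := by
  filter_upwards [h, ae_sin_inner_ne_zero ha] with p hp hsin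
  rw [← sub_eq_zero, ← sub_smul, smul_eq_zero] at hp
  refine hp.resolve_left fun h0 => hsin ?_
  have := congrArg Complex.im h0
  rw [← mul_neg, mul_comm, ← Complex.ofReal_neg, Complex.sub_im, Complex.exp_ofReal_mul_I_im] at this
  simpa using this

/-! ### Fermionic fields are not measurable -/

theorem mainTheorem4 {ι S : Type*} [Fintype S] (Φ : FermionicField ι S)
    (hΦ : ∃ (l : ι) (f : RealTestFunction), Φ.smeared l f ≠ 0) :
    ¬ (Φ.IsHermitian ∧ Φ.SatisfiesMC) := by
  rintro ⟨hH, hMC⟩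
  obtain ⟨l, f, hf⟩ := hΦ
  -- On self-adjoint operators the coefficients of annihilation and creation agree.
  have hfield (g : RealTestFunction) : Φ.smeared l g = Fock.field ((Φ.memLp_v l g).toLp _) := by
    have := Fock.eq_of_isSelfAdjoint_annih_add_create (hH l g)
    rw [FermionicField.smeared, this, Fock.field]
  obtain ⟨a, ha, hsep⟩ := f.exists_spacelikeSeparated_translate
  have hm := hMC l l f (f.translate a) hsep
  rw [hfield, hfield] at hm
  have hne : (Φ.memLp_v l f).toLp _ ≠ 0 := by
    intro h0
    refine hf ?_
    rw [hfield, h0]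
    exact Fock.field_zero
  obtain ⟨c, hc⟩ := Fock.exists_real_smul_of_measurementLeavesInvariant hne hm
  rw [← MeasureTheory.MemLp.toLp_const_smul, MeasureTheory.MemLp.toLp_eq_toLp_iff] at hc
  refine hne ?_
  rw [MeasureTheory.Lp.eq_zero_iff_ae_eq_zero]
  refine (MeasureTheory.MemLp.coeFn_toLp _).trans (ae_eq_zero_of_plane_wave_smul ha (c := c) ?_)
  filter_upwards [hc] with p hp
  refine Eq.trans ?_ hp
  ext σ
  simp [RealTestFunction.waveTransform_translate, mul_assoc]
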